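/- **Theorem (conservation laws of the Einstein equations).** All objects are smooth and repeated indices are summed. Let $T$, $M$ be manifolds of dimensions $p$, $n$, and let $J^1(T,M)$ be their 1-jet bundle with induced coordinates $(t^\alpha,x^i,x^i_\alpha)$. Let $GML^n_p$ be a generalized metrical multi-time Lagrange space, i.e. $J^1(T,M)$ with $G^{(\alpha)(\beta)}_{(i)(j)}=h^{\alpha\beta}(t)\,g_{ij}(t,x,x_\gamma)$, where $h$ is a semi-Riemannian metric on $T$ and $g_{ij}$ is a symmetric d-tensor on $J^1(T,M)$ of rank $n$ and constant signature. Let $H^\gamma_{\alpha\beta}$ be the Christoffel symbols of $h$, let $M^{(i)}_{(\alpha)\beta}=-H^\gamma_{\alpha\beta}x^i_\gamma$, let $N^{(i)}_{(\alpha)j}$ be any spatial nonlinear connection, and let $$\frac{\delta}{\delta t^\alpha}=\frac{\partial}{\partial t^\alpha}-M^{(j)}_{(\beta)\alpha}\frac{\partial}{\partial x^j_\beta},\qquad \frac{\delta}{\delta x^i}=\frac{\partial}{\partial x^i}-N^{(j)}_{(\beta)i}\frac{\partial}{\partial x^j_\beta},\qquad \frac{\partial}{\partial x^i_\alpha}$$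 be the adapted basis $(X_A)$, with dual basis $dt^\alpha,\ dx^i,\ \delta x^i_\alpha$. Let $C\Gamma=(H^\gamma_{\alpha\beta},G^k_{j\gamma},L^i_{jk},C^{i(\gamma)}_{j(k)})$ be the Cartan canonical connection, $$G^k_{j\gamma}=\tfrac{g^{ki}}2\tfrac{\delta g_{ij}}{\delta t^\gamma},\quad L^i_{jk}=\tfrac{g^{im}}2\Big(\tfrac{\delta g_{mj}}{\delta x^k}+\tfrac{\delta g_{mk}}{\delta x^j}-\tfrac{\delta g_{jk}}{\delta x^m}\Big),\quad C^{i(\gamma)}_{j(k)}=\tfrac{g^{im}}2\Big(\tfrac{\partial g_{mj}}{\partial x^k_\gamma}+\tfrac{\partial g_{mk}}{\partial x^j_\gamma}-\tfrac{\partial g_{jk}}{\partial x^m_\gamma}\Big),$$ that is, the linear connection $\nabla$ on $J^1(T,M)$ with $$\nabla_{\delta/\delta t^\gamma}\tfrac{\delta}{\delta t^\alpha}=H^\beta_{\alpha\gamma}\tfrac{\delta}{\delta t^\beta},\quad \nabla_{\delta/\delta x^k}\tfrac{\delta}{\delta t^\alpha}=\nabla_{\partial/\partial x^k_\gamma}\tfrac{\delta}{\delta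 t^\alpha}=0,$$ $$\nabla_{\delta/\delta t^\gamma}\tfrac{\delta}{\delta x^i}=G^k_{i\gamma}\tfrac{\delta}{\delta x^k},\quad \nabla_{\delta/\delta x^j}\tfrac{\delta}{\delta x^i}=L^k_{ij}\tfrac{\delta}{\delta x^k},\quad \nabla_{\partial/\partial x^j_\gamma}\tfrac{\delta}{\delta x^i}=C^{k(\gamma)}_{i(j)}\tfrac{\delta}{\delta x^k},$$ $$\nabla_{\delta/\delta t^\gamma}\tfrac{\partial}{\partial x^i_\alpha}=G^k_{i\gamma}\tfrac{\partial}{\partial x^k_\alpha}-H^\alpha_{\beta\gamma}\tfrac{\partial}{\partial x^i_\beta},\quad \nabla_{\delta/\delta x^j}\tfrac{\partial}{\partial x^i_\alpha}=L^k_{ij}\tfrac{\partial}{\partial x^k_\alpha},\quad \nabla_{\partial/\partial x^j_\gamma}\tfrac{\partial}{\partial x^i_\alpha}=C^{k(\gamma)}_{i(j)}\tfrac{\partial}{\partial x^k_\alpha}.$$ Write ${}_{/\gamma}$, ${}_{|k}$, $|^{(\gamma)}_{(k)}$ for its covariant derivatives of components along $\delta/\delta t^\gamma$, $\delta/\delta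 x^k$, $\partial/\partial x^k_\gamma$. Put $\mathbf R(X_C,X_B)X_A=R^D_{ABC}X_D$, $R_{AB}=R^D_{ABD}$, and $$G=h_{\alpha\beta}dt^\alpha\otimes dt^\beta+g_{ij}dx^i\otimes dx^j+h^{\alpha\beta}g_{ij}\,\delta x^i_\alpha\otimes\delta x^j_\beta,\qquad Sc=G^{AB}R_{AB}.$$ The d-tensors below are $$H_{\alpha\beta}=H^\mu_{\alpha\beta\mu},\quad R_{i\alpha}=R^m_{i\alpha m},\quad R_{ij}=R^m_{ijm},\quad P^{\ (\alpha)}_{i(j)}=-P^{m(\alpha)}_{im(j)},$$ $$P^{(\alpha)}_{(i)\beta}=P^{m(\alpha)}_{i\beta(m)},\quad P^{(\alpha)}_{(i)j}=P^{m(\alpha)}_{ij(m)},\quad S^{(\alpha)(\beta)}_{(i)(j)}=S^{m(\beta)(\alpha)}_{i(j)(m)},$$ where $$H^\alpha_{\eta\beta\gamma}=\tfrac{\partial H^\alpha_{\eta\beta}}{\partial t^\gamma}-\tfrac{\partial H^\alpha_{\eta\gamma}}{\partial t^\beta}+H^\mu_{\eta\beta}H^\alpha_{\mu\gamma}-H^\mu_{\eta\gamma}H^\alpha_{\mu\beta},$$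 $$R^l_{i\beta k}=\tfrac{\delta G^l_{i\beta}}{\delta x^k}-\tfrac{\delta L^l_{ik}}{\delta t^\beta}+G^m_{i\beta}L^l_{mk}-L^m_{ik}G^l_{m\beta}+C^{l(\mu)}_{i(m)}\Big(\tfrac{\delta M^{(m)}_{(\mu)\beta}}{\delta x^k}-\tfrac{\delta N^{(m)}_{(\mu)k}}{\delta t^\beta}\Big),$$ $$R^l_{ijk}=\tfrac{\delta L^l_{ij}}{\delta x^k}-\tfrac{\delta L^l_{ik}}{\delta x^j}+L^m_{ij}L^l_{mk}-L^m_{ik}L^l_{mj}+C^{l(\mu)}_{i(m)}\Big(\tfrac{\delta N^{(m)}_{(\mu)j}}{\delta x^k}-\tfrac{\delta N^{(m)}_{(\mu)k}}{\delta x^j}\Big),$$ $$P^{l(\gamma)}_{i\beta(k)}=\tfrac{\partial G^l_{i\beta}}{\partial x^k_\gamma}-C^{l(\gamma)}_{i(k)/\beta}+C^{l(\mu)}_{i(m)}\Big(\tfrac{\partial M^{(m)}_{(\mu)\beta}}{\partial x^k_\gamma}-\delta^\gamma_\mu G^m_{k\beta}+\delta^m_kH^\gamma_{\mu\beta}\Big),$$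 $$P^{l(\gamma)}_{ij(k)}=\tfrac{\partial L^l_{ij}}{\partial x^k_\gamma}-C^{l(\gamma)}_{i(k)|j}+C^{l(\mu)}_{i(m)}\Big(\tfrac{\partial N^{(m)}_{(\mu)j}}{\partial x^k_\gamma}-\delta^\gamma_\mu L^m_{kj}\Big),$$ $$S^{l(\beta)(\gamma)}_{i(j)(k)}=\tfrac{\partial C^{l(\beta)}_{i(j)}}{\partial x^k_\gamma}-\tfrac{\partial C^{l(\gamma)}_{i(k)}}{\partial x^j_\beta}+C^{m(\beta)}_{i(j)}C^{l(\gamma)}_{m(k)}-C^{m(\gamma)}_{i(k)}C^{l(\beta)}_{m(j)}.$$ Put $H=h^{\alpha\beta}H_{\alpha\beta}$, $R=g^{ij}R_{ij}$, $S=h_{\alpha\beta}g^{ij}S^{(\alpha)(\beta)}_{(i)(j)}$, and $$H^\alpha_\beta=h^{\alpha\mu}H_{\mu\beta},\quad R^i_\beta=g^{im}R_{m\beta},\quad R^i_j=g^{im}R_{mj},\quad P^{i(\beta)}_{\ \ (j)}=g^{im}P^{\ (\beta)}_{m(j)},$$ $$P^{(i)}_{(\alpha)\beta}=g^{im}h_{\alpha\mu}P^{(\mu)}_{(m)\beta},\quad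 P^{(i)}_{(\alpha)j}=g^{im}h_{\alpha\mu}P^{(\mu)}_{(m)j},\quad S^{(i)(\beta)}_{(\alpha)(j)}=g^{im}h_{\alpha\mu}S^{(\mu)(\beta)}_{(m)(j)}.$$ Let $\mathcal K$ be a real constant and $\mathcal T$ (the stress-energy d-tensor) a covariant 2-tensor on $J^1(T,M)$. Suppose that the Einstein equations $R_{AB}-\frac{Sc}{2}G_{AB}=\mathcal K\mathcal T_{AB}$ hold and that $\mathcal T$ is conserved, i.e. $\mathcal T^B_{A|B}=0$ for every adapted index $A$, where $\mathcal T^B_A=G^{BD}\mathcal T_{DA}$ and the divergence is taken with respect to $C\Gamma$. Then, in all induced coordinates, $$\Big[H^\mu_\beta-\frac{H+R+S}2\delta^\mu_\beta\Big]_{/\mu}=-R^m_{\beta|m}-P^{(m)}_{(\mu)\beta}\big|^{(\mu)}_{(m)},$$ $$\Big[R^m_j-\frac{H+R+S}2\delta^m_j\Big]_{|m}=-P^{(m)}_{(\mu)j}\big|^{(\mu)}_{(m)},$$ $$\Big[S^{(m)(\beta)}_{(\mu)(j)}-\frac{H+R+S}2\delta^m_j\delta^\beta_\mu\Big]\Big|^{(\mu)}_{(m)}=-P^{m(\beta)}_{\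 \ (j)|m}.$$ -/

import Mathlib

open scoped Manifold ContDiff Matrix

noncomputable section

namespace GML

/-! Coordinate formulas in one induced chart of `J¹(T,M)`. -/

/-- Local coordinates `(t^α, x^i, x^i_α)` on `J¹(T,M)`; `z.2.2 i α` is `x^i_α`. -/
abbrev JetCoord (p n : ℕ) : Type := (Fin p → ℝ) × (Fin n → ℝ) × (Fin n → Fin p → ℝ)

/-- Adapted indices: temporal `α`, spatial `i`, vertical `(i)(α)`. -/
abbrev Idx (p n : ℕ) : Type := Fin p ⊕ (Fin n ⊕ (Fin n × Fin p))

abbrev tI {p n : ℕ} (α : Fin p) : Idx p n := Sum.inl α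

abbrev xI {p n : ℕ} (i : Fin n) : Idx p n := Sum.inr (Sum.inl i)

abbrev yI {p n : ℕ} (i : Fin n) (α : Fin p) : Idx p n := Sum.inr (Sum.inr (i, α))

/-- Kronecker symbol. -/
def kr {ι : Type} [DecidableEq ι] (a b : ι) : ℝ := if a = b then 1 else 0

/-- The data in one induced chart: the temporal metric `h_{αβ}(t)`, the spatial metrical d-tensor
`g_{ij}(t,x,y)` and the spatial nonlinear connection `N z i α j = N^{(i)}_{(α)j}(z)`. -/
structure LocalData (p n : ℕ) where
  h : (Fin p → ℝ) → Matrix (Fin p) (Fin p) ℝ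
  g : JetCoord p n → Matrix (Fin n) (Fin n) ℝ
  N : JetCoord p n → Fin n → Fin p → Fin n → ℝ

namespace LocalData

variable {p n : ℕ} (D : LocalData p n)

/-- `∂h_{αβ}/∂t^γ`. -/
def dh (α β γ : Fin p) (τ : Fin p → ℝ) : ℝ :=
  fderiv ℝ (fun σ => D.h σ α β) τ (Pi.single γ 1)

/-- Christoffel symbols `H^γ_{αβ}` of `h`. -/
def chr (γ α β : Fin p) (τ : Fin p → ℝ) : ℝ :=
  ∑ μ, (D.h τ)⁻¹ γ μ / 2 * (D.dh μ α β τ + D.dh μ β α τ - D.dh α β μ τ)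

/-- Canonical temporal nonlinear connection `M^{(i)}_{(α)β} = -H^γ_{αβ} x^i_γ`. -/
def tempN (i : Fin n) (α β : Fin p) (z : JetCoord p n) : ℝ :=
  -∑ γ, D.chr γ α β z.1 * z.2.2 i γ

/-- Adapted basis `δ/δt^α = ∂/∂t^α - M^{(j)}_{(β)α} ∂/∂x^j_β`,
`δ/δx^i = ∂/∂x^i - N^{(j)}_{(β)i} ∂/∂x^j_β`, `∂/∂x^i_α`, as vector fields in coordinates. -/
def frame : Idx p n → JetCoord p n → JetCoord p n
  | Sum.inl α => fun z => (Pi.single α 1, 0, fun j β => -D.tempN j β α z)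
  | Sum.inr (Sum.inl i) => fun z => (0, Pi.single i 1, fun j β => -D.N z j β i)
  | Sum.inr (Sum.inr (i, α)) => fun _ => (0, 0, Pi.single i (Pi.single α 1))

/-- Dual basis `dt^α`, `dx^i`, `δx^i_α = dx^i_α + M^{(i)}_{(α)β} dt^β + N^{(i)}_{(α)j} dx^j`
at `z`, applied to a tangent vector `v`. -/
def coframe : Idx p n → JetCoord p n → JetCoord p n → ℝ
  | Sum.inl α => fun _ v => v.1 α
  | Sum.inr (Sum.inl i) => fun _ v => v.2.1 i
  | Sum.inr (Sum.inr (i, α)) => fun z v =>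
      v.2.2 i α + ∑ β, D.tempN i α β z * v.1 β + ∑ j, D.N z i α j * v.2.1 j

/-- Derivative of a function along the adapted basis field `X_A`. -/
def der (A : Idx p n) (f : JetCoord p n → ℝ) (z : JetCoord p n) : ℝ :=
  fderiv ℝ f z (D.frame A z)

/-- `X_A (g_{ij})`. -/
def dg (i j : Fin n) (A : Idx p n) (z : JetCoord p n) : ℝ := D.der A (fun w => D.g w i j) z

/-- `G^k_{jγ} = (g^{ki}/2) δg_{ij}/δt^γ`. -/
def G (k j : Fin n) (γ : Fin p) (z : JetCoord p n) : ℝ :=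
  ∑ i, (D.g z)⁻¹ k i / 2 * D.dg i j (tI γ) z

/-- `L^i_{jk}`. -/
def L (i j k : Fin n) (z : JetCoord p n) : ℝ :=
  ∑ m, (D.g z)⁻¹ i m / 2 * (D.dg m j (xI k) z + D.dg m k (xI j) z - D.dg j k (xI m) z)

/-- `C i j k γ = C^{i(γ)}_{j(k)}`. -/
def C (i j k : Fin n) (γ : Fin p) (z : JetCoord p n) : ℝ :=
  ∑ m, (D.g z)⁻¹ i m / 2 *
    (D.dg m j (yI k γ) z + D.dg m k (yI j γ) z - D.dg j k (yI m γ) z)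

/-! The Cartan canonical connection, its curvature and Ricci tensor, and the Sasaki-like metric,
as objects on the jet space. -/

/-- Coefficients of the Cartan canonical (`h`-normal) connection in the adapted basis:
`∇_{X_B} X_A = ∑_E (conn E A B) X_E`. -/
def conn : Idx p n → Idx p n → Idx p n → JetCoord p n → ℝ
  | Sum.inl γ, Sum.inl α, Sum.inl β => fun z => D.chr γ α β z.1
  | Sum.inr (Sum.inl k), Sum.inr (Sum.inl j), Sum.inl γ => D.G k j γ
  | Sum.inr (Sum.inl k), Sum.inr (Sum.inl i), Sum.inr (Sum.inl j) => D.L k i j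
  | Sum.inr (Sum.inl k), Sum.inr (Sum.inl i), Sum.inr (Sum.inr (j, γ)) => D.C k i j γ
  | Sum.inr (Sum.inr (k, β)), Sum.inr (Sum.inr (i, α)), Sum.inl γ => fun z =>
      kr α β * D.G k i γ z - kr k i * D.chr α β γ z.1
  | Sum.inr (Sum.inr (k, β)), Sum.inr (Sum.inr (i, α)), Sum.inr (Sum.inl j) => fun z =>
      kr α β * D.L k i j z
  | Sum.inr (Sum.inr (k, β)), Sum.inr (Sum.inr (i, α)), Sum.inr (Sum.inr (j, γ)) => fun z =>
      kr α β * D.C k i j γ z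
  | _, _, _ => fun _ => 0

/-- The covariant derivative `∇_V W` of vector fields on the jet space. -/
def nabla (V W : JetCoord p n → JetCoord p n) (z : JetCoord p n) : JetCoord p n :=
  ∑ E, (fderiv ℝ (fun w => D.coframe E w (W w)) z (V z) +
    ∑ A, ∑ B, D.conn E A B z * D.coframe A z (W z) * D.coframe B z (V z)) • D.frame E z

/-- The curvature `R(V,W)Z = ∇_V ∇_W Z - ∇_W ∇_V Z - ∇_{[V,W]} Z`. -/
def curv (V W Z : JetCoord p n → JetCoord p n) (z : JetCoord p n) : JetCoord p n :=
  D.nabla V (D.nabla W Z) z - D.nabla W (D.nabla V Z) z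
    - D.nabla (VectorField.lieBracket ℝ V W) Z z

/-- Adapted components `R^E_{ABC}` given by `R(X_C,X_B)X_A = R^E_{ABC} X_E`. -/
def curvComp (E A B C : Idx p n) (z : JetCoord p n) : ℝ :=
  D.coframe E z (D.curv (D.frame C) (D.frame B) (D.frame A) z)

/-- Ricci d-tensor `R_{AB} = R^E_{ABE}`. -/
def ric (A B : Idx p n) (z : JetCoord p n) : ℝ := ∑ E, D.curvComp E A B E z

/-- Adapted components of
`h_{αβ} dt^α dt^β + g_{ij} dx^i dx^j + h^{αβ} g_{ij} δx^i_α δx^j_β`. -/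
def met : Idx p n → Idx p n → JetCoord p n → ℝ
  | Sum.inl α, Sum.inl β => fun z => D.h z.1 α β
  | Sum.inr (Sum.inl i), Sum.inr (Sum.inl j) => fun z => D.g z i j
  | Sum.inr (Sum.inr (i, α)), Sum.inr (Sum.inr (j, β)) => fun z => (D.h z.1)⁻¹ α β * D.g z i j
  | _, _ => fun _ => 0

/-- Components of the inverse metric. -/
def metInv : Idx p n → Idx p n → JetCoord p n → ℝ
  | Sum.inl α, Sum.inl β => fun z => (D.h z.1)⁻¹ α β
  | Sum.inr (Sum.inl i), Sum.inr (Sum.inl j) => fun z => (D.g z)⁻¹ i j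
  | Sum.inr (Sum.inr (i, α)), Sum.inr (Sum.inr (j, β)) => fun z => D.h z.1 α β * (D.g z)⁻¹ i j
  | _, _ => fun _ => 0

/-- Scalar curvature `Sc(CΓ) = G^{AB} R_{AB}`. -/
def sc (z : JetCoord p n) : ℝ := ∑ A, ∑ B, D.metInv A B z * D.ric A B z

/-- `𝒯^B_A = G^{BE} 𝒯_{EA}`. -/
def raise (T : Idx p n → Idx p n → JetCoord p n → ℝ) (B A : Idx p n) (z : JetCoord p n) : ℝ :=
  ∑ E, D.metInv B E z * T E A z

/-- Components `X^B_{A|C}` of the covariant derivative of a `(1,1)` tensor field. -/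
def covDer (X : Idx p n → Idx p n → JetCoord p n → ℝ) (B A C : Idx p n)
    (z : JetCoord p n) : ℝ :=
  D.der C (X B A) z + ∑ E, D.conn B E C z * X E A z - ∑ E, D.conn E A C z * X B E z

/-- The divergence `𝒯^B_{A|B}`. -/
def divergence (T : Idx p n → Idx p n → JetCoord p n → ℝ) (A : Idx p n)
    (z : JetCoord p n) : ℝ :=
  ∑ B, D.covDer (D.raise T) B A B z

/-! The torsion and curvature d-tensors of the Cartan canonical connection that occur below. -/

/-- `R^{(m)}_{(μ)αj} = δM^{(m)}_{(μ)α}/δx^j - δN^{(m)}_{(μ)j}/δt^α`. -/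
def torRtx (m : Fin n) (μ α : Fin p) (j : Fin n) (z : JetCoord p n) : ℝ :=
  D.der (xI j) (D.tempN m μ α) z - D.der (tI α) (fun w => D.N w m μ j) z

/-- `R^{(m)}_{(μ)ij} = δN^{(m)}_{(μ)i}/δx^j - δN^{(m)}_{(μ)j}/δx^i`. -/
def torRxx (m : Fin n) (μ : Fin p) (i j : Fin n) (z : JetCoord p n) : ℝ :=
  D.der (xI j) (fun w => D.N w m μ i) z - D.der (xI i) (fun w => D.N w m μ j) z

/-- `torPt m μ α j β = P^{(m)(β)}_{(μ)α(j)}`. -/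
def torPt (m : Fin n) (μ α : Fin p) (j : Fin n) (β : Fin p) (z : JetCoord p n) : ℝ :=
  D.der (yI j β) (D.tempN m μ α) z - kr β μ * D.G m j α z + kr m j * D.chr β μ α z.1

/-- `torPx m μ i j β = P^{(m)(β)}_{(μ)i(j)}`. -/
def torPx (m : Fin n) (μ : Fin p) (i j : Fin n) (β : Fin p) (z : JetCoord p n) : ℝ :=
  D.der (yI j β) (fun w => D.N w m μ i) z - kr β μ * D.L m j i z

/-- `C^{l(γ)}_{i(k)/β}`. -/
def covTC (l i k : Fin n) (γ β : Fin p) (z : JetCoord p n) : ℝ :=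
  D.der (tI β) (D.C l i k γ) z + ∑ m, D.C m i k γ z * D.G l m β z
    - ∑ m, D.C l m k γ z * D.G m i β z - ∑ m, D.C l i m γ z * D.G m k β z
    + ∑ μ, D.C l i k μ z * D.chr γ μ β z.1

/-- `C^{l(γ)}_{i(k)|j}`. -/
def covMC (l i k : Fin n) (γ : Fin p) (j : Fin n) (z : JetCoord p n) : ℝ :=
  D.der (xI j) (D.C l i k γ) z + ∑ m, D.C m i k γ z * D.L l m j z
    - ∑ m, D.C l m k γ z * D.L m i j z - ∑ m, D.C l i m γ z * D.L m k j z

/-- `H^α_{ηβγ}`, the curvature of `h`. -/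
def curvH (α η β γ : Fin p) (τ : Fin p → ℝ) : ℝ :=
  fderiv ℝ (D.chr α η β) τ (Pi.single γ 1) - fderiv ℝ (D.chr α η γ) τ (Pi.single β 1)
    + ∑ μ, (D.chr μ η β τ * D.chr α μ γ τ - D.chr μ η γ τ * D.chr α μ β τ)

/-- `R^l_{iβk}`. -/
def curvRtx (l i : Fin n) (β : Fin p) (k : Fin n) (z : JetCoord p n) : ℝ :=
  D.der (xI k) (D.G l i β) z - D.der (tI β) (D.L l i k) z
    + ∑ m, (D.G m i β z * D.L l m k z - D.L m i k z * D.G l m β z)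
    + ∑ m, ∑ μ, D.C l i m μ z * D.torRtx m μ β k z

/-- `R^l_{ijk}`. -/
def curvRxx (l i j k : Fin n) (z : JetCoord p n) : ℝ :=
  D.der (xI k) (D.L l i j) z - D.der (xI j) (D.L l i k) z
    + ∑ m, (D.L m i j z * D.L l m k z - D.L m i k z * D.L l m j z)
    + ∑ m, ∑ μ, D.C l i m μ z * D.torRxx m μ j k z

/-- `curvPt l i β k γ = P^{l(γ)}_{iβ(k)}`. -/
def curvPt (l i : Fin n) (β : Fin p) (k : Fin n) (γ : Fin p) (z : JetCoord p n) : ℝ :=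
  D.der (yI k γ) (D.G l i β) z - D.covTC l i k γ β z
    + ∑ m, ∑ μ, D.C l i m μ z * D.torPt m μ β k γ z

/-- `curvPx l i j k γ = P^{l(γ)}_{ij(k)}`. -/
def curvPx (l i j k : Fin n) (γ : Fin p) (z : JetCoord p n) : ℝ :=
  D.der (yI k γ) (D.L l i j) z - D.covMC l i k γ j z
    + ∑ m, ∑ μ, D.C l i m μ z * D.torPx m μ j k γ z

/-- `curvS l i j β k γ = S^{l(β)(γ)}_{i(j)(k)}`. -/
def curvS (l i j : Fin n) (β : Fin p) (k : Fin n) (γ : Fin p) (z : JetCoord p n) : ℝ :=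
  D.der (yI k γ) (D.C l i j β) z - D.der (yI j β) (D.C l i k γ) z
    + ∑ m, (D.C m i j β z * D.C l m k γ z - D.C m i k γ z * D.C l m j β z)

/-! Ricci components with lower indices. -/

/-- `H_{αβ} = H^μ_{αβμ}`. -/
def ricH (α β : Fin p) (z : JetCoord p n) : ℝ := ∑ μ, D.curvH μ α β μ z.1

/-- `R_{iα} = R^m_{iαm}`. -/
def ricRt (i : Fin n) (α : Fin p) (z : JetCoord p n) : ℝ := ∑ m, D.curvRtx m i α m z

/-- `R_{ij} = R^m_{ijm}`. -/
def ricR (i j : Fin n) (z : JetCoord p n) : ℝ := ∑ m, D.curvRxx m i j m z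

/-- `ricPxy i j α = P^{(α)}_{i(j)} = -P^{m(α)}_{im(j)}`. -/
def ricPxy (i j : Fin n) (α : Fin p) (z : JetCoord p n) : ℝ := -∑ m, D.curvPx m i m j α z

/-- `ricPyt i α β = P^{(α)}_{(i)β} = P^{m(α)}_{iβ(m)}`. -/
def ricPyt (i : Fin n) (α β : Fin p) (z : JetCoord p n) : ℝ := ∑ m, D.curvPt m i β m α z

/-- `ricPyx i α j = P^{(α)}_{(i)j} = P^{m(α)}_{ij(m)}`. -/
def ricPyx (i : Fin n) (α : Fin p) (j : Fin n) (z : JetCoord p n) : ℝ :=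
  ∑ m, D.curvPx m i j m α z

/-- `ricS i α j β = S^{(α)(β)}_{(i)(j)} = S^{m(β)(α)}_{i(j)(m)}`. -/
def ricS (i : Fin n) (α : Fin p) (j : Fin n) (β : Fin p) (z : JetCoord p n) : ℝ :=
  ∑ m, D.curvS m i j β m α z

/-- `H = h^{αβ} H_{αβ}`. -/
def scH (z : JetCoord p n) : ℝ := ∑ α, ∑ β, (D.h z.1)⁻¹ α β * D.ricH α β z

/-- `R = g^{ij} R_{ij}`. -/
def scR (z : JetCoord p n) : ℝ := ∑ i, ∑ j, (D.g z)⁻¹ i j * D.ricR i j z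

/-- `S = h_{αβ} g^{ij} S^{(α)(β)}_{(i)(j)}`. -/
def scS (z : JetCoord p n) : ℝ :=
  ∑ α, ∑ β, ∑ i, ∑ j, D.h z.1 α β * (D.g z)⁻¹ i j * D.ricS i α j β z

/-! Mixed components. -/

/-- `H^α_β = h^{αμ} H_{μβ}`. -/
def mixH (α β : Fin p) (z : JetCoord p n) : ℝ := ∑ μ, (D.h z.1)⁻¹ α μ * D.ricH μ β z

/-- `R^i_β = g^{im} R_{mβ}`. -/
def mixRt (i : Fin n) (β : Fin p) (z : JetCoord p n) : ℝ := ∑ m, (D.g z)⁻¹ i m * D.ricRt m β z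

/-- `R^i_j = g^{im} R_{mj}`. -/
def mixR (i j : Fin n) (z : JetCoord p n) : ℝ := ∑ m, (D.g z)⁻¹ i m * D.ricR m j z

/-- `P^{(i)}_{(α)β} = g^{im} h_{αμ} P^{(μ)}_{(m)β}`. -/
def mixPyt (i : Fin n) (α β : Fin p) (z : JetCoord p n) : ℝ :=
  ∑ m, ∑ μ, (D.g z)⁻¹ i m * D.h z.1 α μ * D.ricPyt m μ β z

/-- `mixPxy i j β = P^{i(β)}_{(j)} = g^{im} P^{(β)}_{m(j)}`. -/
def mixPxy (i j : Fin n) (β : Fin p) (z : JetCoord p n) : ℝ :=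
  ∑ m, (D.g z)⁻¹ i m * D.ricPxy m j β z

/-- `P^{(i)}_{(α)j} = g^{im} h_{αμ} P^{(μ)}_{(m)j}`. -/
def mixPyx (i : Fin n) (α : Fin p) (j : Fin n) (z : JetCoord p n) : ℝ :=
  ∑ m, ∑ μ, (D.g z)⁻¹ i m * D.h z.1 α μ * D.ricPyx m μ j z

/-- `mixS i α j β = S^{(i)(β)}_{(α)(j)} = g^{im} h_{αμ} S^{(μ)(β)}_{(m)(j)}`. -/
def mixS (i : Fin n) (α : Fin p) (j : Fin n) (β : Fin p) (z : JetCoord p n) : ℝ :=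
  ∑ m, ∑ μ, (D.g z)⁻¹ i m * D.h z.1 α μ * D.ricS m μ j β z

/-! Local covariant derivatives of d-tensors of the types that occur in the conservation laws. -/

/-- `X^μ_{β/γ}` for a d-tensor `X^μ_β`. -/
def covTtt (X : Fin p → Fin p → JetCoord p n → ℝ) (μ β γ : Fin p) (z : JetCoord p n) : ℝ :=
  D.der (tI γ) (X μ β) z + ∑ ν, X ν β z * D.chr μ ν γ z.1 - ∑ ν, X μ ν z * D.chr ν β γ z.1

/-- `X^m_{β|k}` for a d-tensor `X^m_β`. -/
def covMxt (X : Fin n → Fin p → JetCoord p n → ℝ) (m : Fin n) (β : Fin p) (k : Fin n)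
    (z : JetCoord p n) : ℝ :=
  D.der (xI k) (X m β) z + ∑ r, X r β z * D.L m r k z

/-- `X^{(m)}_{(μ)β}|^{(γ)}_{(k)}` for a d-tensor `X^{(m)}_{(μ)β}`. -/
def covVyt (X : Fin n → Fin p → Fin p → JetCoord p n → ℝ) (m : Fin n) (μ β : Fin p)
    (k : Fin n) (γ : Fin p) (z : JetCoord p n) : ℝ :=
  D.der (yI k γ) (X m μ β) z + ∑ r, X r μ β z * D.C m r k γ z

/-- `X^m_{j|k}` for a d-tensor `X^m_j`. -/
def covMxx (X : Fin n → Fin n → JetCoord p n → ℝ) (m j k : Fin n) (z : JetCoord p n) : ℝ :=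
  D.der (xI k) (X m j) z + ∑ r, X r j z * D.L m r k z - ∑ r, X m r z * D.L r j k z

/-- `X^{(m)}_{(μ)j}|^{(γ)}_{(k)}` for a d-tensor `X^{(m)}_{(μ)j}`. -/
def covVyx (X : Fin n → Fin p → Fin n → JetCoord p n → ℝ) (m : Fin n) (μ : Fin p) (j k : Fin n)
    (γ : Fin p) (z : JetCoord p n) : ℝ :=
  D.der (yI k γ) (X m μ j) z + ∑ r, X r μ j z * D.C m r k γ z - ∑ r, X m μ r z * D.C r j k γ z

/-- `X^{(m)(β)}_{(μ)(j)}|^{(γ)}_{(k)}` for a d-tensor `X m μ j β = X^{(m)(β)}_{(μ)(j)}`. -/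
def covVyy (X : Fin n → Fin p → Fin n → Fin p → JetCoord p n → ℝ) (m : Fin n) (μ : Fin p)
    (j : Fin n) (β : Fin p) (k : Fin n) (γ : Fin p) (z : JetCoord p n) : ℝ :=
  D.der (yI k γ) (X m μ j β) z + ∑ r, X r μ j β z * D.C m r k γ z
    - ∑ r, X m μ r β z * D.C r j k γ z

/-- `X^{m(β)}_{(j)|k}` for a d-tensor `X m j β = X^{m(β)}_{(j)}`. -/
def covMxy (X : Fin n → Fin n → Fin p → JetCoord p n → ℝ) (m j : Fin n) (β : Fin p) (k : Fin n)
    (z : JetCoord p n) : ℝ :=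
  D.der (xI k) (X m j β) z + ∑ r, X r j β z * D.L m r k z - ∑ r, X m r β z * D.L r j k z

end LocalData

/-! The global objects: tensors on manifolds and d-tensors on `J¹(T,M)` as compatible families of
local components, one for each pair of charts of the smooth structures of `T` and `M`. -/

/-- Jacobian matrix. -/
def jac {k l : ℕ} (F : (Fin k → ℝ) → (Fin l → ℝ)) (x : Fin k → ℝ) :
    Matrix (Fin l) (Fin k) ℝ :=
  Matrix.of fun i j => fderiv ℝ F x (Pi.single j 1) i

section Global

variable (p n : ℕ) (T M : Type*)
  [TopologicalSpace T] [ChartedSpace (Fin p → ℝ) T] [IsManifold 𝓘(ℝ, Fin p → ℝ) ∞ T]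
  [TopologicalSpace M] [ChartedSpace (Fin n → ℝ) M] [IsManifold 𝓘(ℝ, Fin n → ℝ) ∞ M]

/-- The charts of a smooth manifold. -/
def charts (k : ℕ) (X : Type*) [TopologicalSpace X] [ChartedSpace (Fin k → ℝ) X] :
    Set (OpenPartialHomeomorph X (Fin k → ℝ)) :=
  IsManifold.maximalAtlas 𝓘(ℝ, Fin k → ℝ) ∞ X

variable {p n T M}

/-- Range of the induced coordinates on `J¹(T,M)`. -/
def dom (φ : OpenPartialHomeomorph T (Fin p → ℝ)) (ψ : OpenPartialHomeomorph M (Fin n → ℝ)) :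
    Set (JetCoord p n) :=
  {z | z.1 ∈ φ.target ∧ z.2.1 ∈ ψ.target}

/-- The part of `dom φ ψ` that is also covered by the charts `φ'`, `ψ'`. -/
def overlap (φ φ' : OpenPartialHomeomorph T (Fin p → ℝ))
    (ψ ψ' : OpenPartialHomeomorph M (Fin n → ℝ)) : Set (JetCoord p n) :=
  {z | z ∈ dom φ ψ ∧ φ.symm z.1 ∈ φ'.source ∧ ψ.symm z.2.1 ∈ ψ'.source}

/-- The change of induced coordinates on `J¹(T,M)`:
`t̃ = t̃(t)`, `x̃ = x̃(x)`, `x̃^i_α = (∂x̃^i/∂x^j) (∂t^β/∂t̃^α) x^j_β`. -/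
def jetChange (φ φ' : OpenPartialHomeomorph T (Fin p → ℝ))
    (ψ ψ' : OpenPartialHomeomorph M (Fin n → ℝ)) (z : JetCoord p n) : JetCoord p n :=
  (φ' (φ.symm z.1), ψ' (ψ.symm z.2.1), fun i α => ∑ j, ∑ β,
    jac (ψ' ∘ ψ.symm) z.2.1 i j * jac (φ ∘ φ'.symm) (φ' (φ.symm z.1)) β α * z.2.2 j β)

variable (p n T M)

/-- A generalized metrical multi-time Lagrange space: a semi-Riemannian metric `h` on `T` and a
symmetric d-tensor `g_{ij}` on `J¹(T,M)` of rank `n` and constant signature; its vertical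
fundamental metrical d-tensor is `h^{αβ} g_{ij}`. -/
structure Space where
  h : OpenPartialHomeomorph T (Fin p → ℝ) → (Fin p → ℝ) → Matrix (Fin p) (Fin p) ℝ
  g : OpenPartialHomeomorph T (Fin p → ℝ) → OpenPartialHomeomorph M (Fin n → ℝ) →
    JetCoord p n → Matrix (Fin n) (Fin n) ℝ
  h_smooth : ∀ φ ∈ charts p T, ∀ α β, ContDiffOn ℝ ∞ (fun τ => h φ τ α β) φ.target
  h_symm : ∀ φ ∈ charts p T, ∀ τ ∈ φ.target, (h φ τ).IsSymm
  h_det : ∀ φ ∈ charts p T, ∀ τ ∈ φ.target, (h φ τ).det ≠ 0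
  h_signature : ∃ s : Fin p → ℝ, (∀ α, s α = 1 ∨ s α = -1) ∧
    ∀ φ ∈ charts p T, ∀ τ ∈ φ.target,
      ∃ Q : Matrix (Fin p) (Fin p) ℝ, Qᵀ * h φ τ * Q = Matrix.diagonal s
  h_tensor : ∀ φ ∈ charts p T, ∀ φ' ∈ charts p T, ∀ τ ∈ φ.target, φ.symm τ ∈ φ'.source →
    h φ τ = (jac (φ' ∘ φ.symm) τ)ᵀ * h φ' (φ' (φ.symm τ)) * jac (φ' ∘ φ.symm) τ
  g_smooth : ∀ φ ∈ charts p T, ∀ ψ ∈ charts n M, ∀ i j,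
    ContDiffOn ℝ ∞ (fun z => g φ ψ z i j) (dom φ ψ)
  g_symm : ∀ φ ∈ charts p T, ∀ ψ ∈ charts n M, ∀ z ∈ dom φ ψ, (g φ ψ z).IsSymm
  g_det : ∀ φ ∈ charts p T, ∀ ψ ∈ charts n M, ∀ z ∈ dom φ ψ, (g φ ψ z).det ≠ 0
  g_signature : ∃ s : Fin n → ℝ, (∀ i, s i = 1 ∨ s i = -1) ∧
    ∀ φ ∈ charts p T, ∀ ψ ∈ charts n M, ∀ z ∈ dom φ ψ,
      ∃ Q : Matrix (Fin n) (Fin n) ℝ, Qᵀ * g φ ψ z * Q = Matrix.diagonal s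
  g_tensor : ∀ φ ∈ charts p T, ∀ φ' ∈ charts p T, ∀ ψ ∈ charts n M, ∀ ψ' ∈ charts n M,
    ∀ z ∈ overlap φ φ' ψ ψ',
      g φ ψ z = (jac (ψ' ∘ ψ.symm) z.2.1)ᵀ * g φ' ψ' (jetChange φ φ' ψ ψ' z) *
        jac (ψ' ∘ ψ.symm) z.2.1

variable {p n T M}

/-- A spatial nonlinear connection `N^{(i)}_{(α)j}` on `J¹(T,M)`. The law of transformation says
that a change of coordinates maps `δ/δx^i` to a combination of the new `δ/δx̃^k`
(no new vertical component `δx̃^j_β`). -/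
structure SpatialConnection (𝒮 : Space p n T M) where
  N : OpenPartialHomeomorph T (Fin p → ℝ) → OpenPartialHomeomorph M (Fin n → ℝ) →
    JetCoord p n → Fin n → Fin p → Fin n → ℝ
  smooth : ∀ φ ∈ charts p T, ∀ ψ ∈ charts n M, ∀ i α j,
    ContDiffOn ℝ ∞ (fun z => N φ ψ z i α j) (dom φ ψ)
  transform : ∀ φ ∈ charts p T, ∀ φ' ∈ charts p T, ∀ ψ ∈ charts n M, ∀ ψ' ∈ charts n M,
    ∀ z ∈ overlap φ φ' ψ ψ', ∀ (i j : Fin n) (β : Fin p),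
      (LocalData.mk (𝒮.h φ') (𝒮.g φ' ψ') (N φ' ψ')).coframe (yI j β) (jetChange φ φ' ψ ψ' z)
        (fderiv ℝ (jetChange φ φ' ψ ψ') z
          ((LocalData.mk (𝒮.h φ) (𝒮.g φ ψ) (N φ ψ)).frame (xI i) z)) = 0

/-- The data of `𝒮` and `Γ` in the coordinates induced by the charts `φ`, `ψ`. -/
def localData (𝒮 : Space p n T M) (Γ : SpatialConnection 𝒮)
    (φ : OpenPartialHomeomorph T (Fin p → ℝ)) (ψ : OpenPartialHomeomorph M (Fin n → ℝ)) :
    LocalData p n :=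
  ⟨𝒮.h φ, 𝒮.g φ ψ, Γ.N φ ψ⟩

/-- A covariant tensor field of order two on `J¹(T,M)` through its adapted components
`𝒯_{AB} = 𝒯(X_A, X_B)`. -/
structure Tensor2 (𝒮 : Space p n T M) (Γ : SpatialConnection 𝒮) where
  comp : OpenPartialHomeomorph T (Fin p → ℝ) → OpenPartialHomeomorph M (Fin n → ℝ) →
    Idx p n → Idx p n → JetCoord p n → ℝ
  smooth : ∀ φ ∈ charts p T, ∀ ψ ∈ charts n M, ∀ A B,
    ContDiffOn ℝ ∞ (comp φ ψ A B) (dom φ ψ)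
  transform : ∀ φ ∈ charts p T, ∀ φ' ∈ charts p T, ∀ ψ ∈ charts n M, ∀ ψ' ∈ charts n M,
    ∀ z ∈ overlap φ φ' ψ ψ', ∀ A B,
      comp φ ψ A B z = ∑ A', ∑ B',
        (localData 𝒮 Γ φ' ψ').coframe A' (jetChange φ φ' ψ ψ' z)
          (fderiv ℝ (jetChange φ φ' ψ ψ') z ((localData 𝒮 Γ φ ψ).frame A z)) *
        (localData 𝒮 Γ φ' ψ').coframe B' (jetChange φ φ' ψ ψ' z)
          (fderiv ℝ (jetChange φ φ' ψ ψ') z ((localData 𝒮 Γ φ ψ).frame B z)) *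
        comp φ' ψ' A' B' (jetChange φ φ' ψ ψ' z)

/-- The Einstein equations `Ric(CΓ) - (Sc(CΓ)/2) G = 𝒦 𝒯`. -/
def EinsteinEquations (𝒮 : Space p n T M) (Γ : SpatialConnection 𝒮) (𝒦 : ℝ)
    (𝒯 : Tensor2 𝒮 Γ) : Prop :=
  ∀ φ ∈ charts p T, ∀ ψ ∈ charts n M, ∀ z ∈ dom φ ψ, ∀ A B,
    (localData 𝒮 Γ φ ψ).ric A B z
      - (localData 𝒮 Γ φ ψ).sc z / 2 * (localData 𝒮 Γ φ ψ).met A B z = 𝒦 * 𝒯.comp φ ψ A B z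

/-- The conservation laws `𝒯^B_{A|B} = 0` of the stress-energy d-tensor. -/
def ConservationLaws (𝒮 : Space p n T M) (Γ : SpatialConnection 𝒮) (𝒯 : Tensor2 𝒮 Γ) : Prop :=
  ∀ φ ∈ charts p T, ∀ ψ ∈ charts n M, ∀ z ∈ dom φ ψ, ∀ A,
    (localData 𝒮 Γ φ ψ).divergence (𝒯.comp φ ψ) A z = 0

end Global

end GML

end

/-! The argument is a block decomposition of one divergence; no Bianchi identity enters. On the open
set covered by an induced chart, raising an index in the Einstein equations shows that the mixed
Einstein tensor equals `𝒦` times the mixed stress-energy tensor. Covariant differentiation commutes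
with the constant, so conservation makes the divergence of the mixed Einstein tensor vanish
(`sum_covDer_einstein_eq_zero`). Its three kinds of lower index, temporal, spatial and vertical,
give the three laws once the sum over the upper index is split into the same three blocks.

The work lies in identifying the blocks. The curvature is defined from `∇` on vector fields, and its
components must be matched with the explicit d-tensors. Brackets of adapted fields are vertical
because the horizontal components of the frame are constant; this gives the coefficient formula
`RegularAt.curvComp_eq`. Since `∇` preserves the temporal, spatial and vertical distributions, only
curvature components whose first two indices lie in the same block survive. Tracing them gives the
nine Ricci blocks, two of which vanish because the temporal coefficients depend on `t` alone. The
block-diagonal inverse metric then yields `Sc = H + R + S` (`RegularAt.sc_eq`) and the mixed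
components (`RegularAt.raise_ric`). Block-diagonality of the connection also reduces each full
covariant derivative to the local one of the statement (`sum_covDer_einstein_t`,
`sum_covDer_einstein_x`, `sum_covDer_einstein_y`). -/

namespace GML

/-! ### Smoothness of determinants and inverse matrices. -/

section Smoothness

variable {E : Type*} [NormedAddCommGroup E] [NormedSpace ℝ E] {k : ℕ} {m : WithTop ℕ∞}
  {A : E → Matrix (Fin k) (Fin k) ℝ} {x : E}

theorem contDiffAt_det (hA : ∀ i j, ContDiffAt ℝ m (fun y => A y i j) x) :
    ContDiffAt ℝ m (fun y => (A y).det) x := by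
  simp only [Matrix.det_apply']
  exact ContDiffAt.sum fun σ _ => contDiffAt_const.mul (contDiffAt_prod fun i _ => hA _ _)

/-- Cramer's rule: each entry is the reciprocal of the determinant times the determinant of the
matrix with one row replaced by a constant basis vector. -/
theorem contDiffAt_matrix_inv (hA : ∀ i j, ContDiffAt ℝ m (fun y => A y i j) x)
    (hdet : (A x).det ≠ 0) (i j : Fin k) : ContDiffAt ℝ m (fun y => (A y)⁻¹ i j) x := by
  simp only [Matrix.inv_def, Ring.inverse_eq_inv', Matrix.smul_apply, smul_eq_mul,
    Matrix.adjugate_apply]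
  refine ((contDiffAt_det hA).inv hdet).mul (contDiffAt_det fun a b => ?_)
  by_cases h : a = j
  · subst h; simpa using contDiffAt_const
  · simpa [Matrix.updateRow_ne h] using hA a b

end Smoothness

namespace LocalData

variable {p n : ℕ} {D : LocalData p n} {z : JetCoord p n}

/-- The data are smooth near `z`, and both metrics are nondegenerate at `z`. -/
structure RegularAt (D : LocalData p n) (z : JetCoord p n) : Prop where
  h_smooth : ∀ α β, ContDiffAt ℝ ∞ (fun τ => D.h τ α β) z.1
  h_det : (D.h z.1).det ≠ 0
  g_smooth : ∀ i j, ContDiffAt ℝ ∞ (fun w => D.g w i j) z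
  g_det : (D.g z).det ≠ 0
  N_smooth : ∀ i α j, ContDiffAt ℝ ∞ (fun w => D.N w i α j) z

/-! ### Smoothness of the connection coefficients and of the adapted frame. -/

namespace RegularAt

theorem chr_smooth (hz : D.RegularAt z) (γ α β : Fin p) :
    ContDiffAt ℝ ∞ (D.chr γ α β) z.1 := by
  have hd : ∀ a b c, ContDiffAt ℝ ∞ (D.dh a b c) z.1 := fun a b c =>
    ((hz.h_smooth a b).fderiv_right (m := ∞) le_rfl).clm_apply contDiffAt_const
  unfold chr
  exact ContDiffAt.sum fun μ _ =>
    ((contDiffAt_matrix_inv hz.h_smooth hz.h_det _ _).div_const 2).mul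
      (((hd _ _ _).add (hd _ _ _)).sub (hd _ _ _))

theorem chr_fst_smooth (hz : D.RegularAt z) (γ α β : Fin p) :
    ContDiffAt ℝ ∞ (fun w : JetCoord p n => D.chr γ α β w.1) z :=
  ContDiffAt.comp (g := D.chr γ α β) z (hz.chr_smooth γ α β) contDiffAt_fst

theorem tempN_smooth (hz : D.RegularAt z) (i : Fin n) (α β : Fin p) :
    ContDiffAt ℝ ∞ (D.tempN i α β) z := by
  unfold tempN
  refine (ContDiffAt.sum fun γ _ => (hz.chr_fst_smooth γ α β).mul ?_).neg
  fun_prop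

theorem frame_vertical_smooth (hz : D.RegularAt z) (A : Idx p n) (i : Fin n) (α : Fin p) :
    ContDiffAt ℝ ∞ (fun w => (D.frame A w).2.2 i α) z := by
  rcases A with α | i | ⟨i, α⟩
  · exact (hz.tempN_smooth _ _ _).neg
  · exact (hz.N_smooth _ _ _).neg
  · exact contDiffAt_const

theorem frame_smooth (hz : D.RegularAt z) (A : Idx p n) : ContDiffAt ℝ ∞ (D.frame A) z := by
  have hv : ContDiffAt ℝ ∞ (fun w => (D.frame A w).2.2) z :=
    contDiffAt_pi.2 fun i => contDiffAt_pi.2 fun α => hz.frame_vertical_smooth A i α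
  rcases A with α | i | ⟨i, α⟩
  · exact contDiffAt_const.prodMk (contDiffAt_const.prodMk hv)
  · exact contDiffAt_const.prodMk (contDiffAt_const.prodMk hv)
  · exact contDiffAt_const

theorem G_smooth (hz : D.RegularAt z) (k j : Fin n) (γ : Fin p) :
    ContDiffAt ℝ ∞ (D.G k j γ) z := by
  unfold G
  exact ContDiffAt.sum fun i _ =>
    ((contDiffAt_matrix_inv hz.g_smooth hz.g_det _ _).div_const 2).mul
      (((hz.g_smooth i j).fderiv_right (m := ∞) le_rfl).clm_apply (hz.frame_smooth (tI γ)))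

end RegularAt

/-! The derivations along the adapted basis. -/

theorem der_const (A : Idx p n) (c : ℝ) : D.der A (fun _ => c) z = 0 := by
  simp [der]

theorem der_congr {f f' : JetCoord p n → ℝ} (A : Idx p n) (h : f =ᶠ[nhds z] f') :
    D.der A f z = D.der A f' z := by
  rw [der, der, h.fderiv_eq]

theorem der_neg (A : Idx p n) (f : JetCoord p n → ℝ) :
    D.der A (fun w => -f w) z = -D.der A f z := by
  simp [der, fderiv_fun_neg]

/-- No differentiability is needed: a nonzero scalar is invertible, and for zero both sides vanish.
Hence the Einstein tensor need not be shown smooth later. -/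
theorem der_const_mul (A : Idx p n) (c : ℝ) (f : JetCoord p n → ℝ) :
    D.der A (fun w => c * f w) z = c * D.der A f z := by
  have : (fun w => c * f w) = c • f := rfl
  rw [der, der, this, fderiv_const_smul_field]; rfl

theorem der_sub (A : Idx p n) {f f' : JetCoord p n → ℝ} (hf : DifferentiableAt ℝ f z)
    (hf' : DifferentiableAt ℝ f' z) :
    D.der A (fun w => f w - f' w) z = D.der A f z - D.der A f' z := by
  simp [der, fderiv_fun_sub hf hf']

/-- Spatial and vertical frame fields have zero temporal component, so this makes them annihilate
functions of `t` alone, such as the Christoffel symbols of `h`. -/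
theorem der_comp_fst {f : (Fin p → ℝ) → ℝ} (hf : DifferentiableAt ℝ f z.1) (A : Idx p n) :
    D.der A (fun w => f w.1) z = fderiv ℝ f z.1 (D.frame A z).1 := by
  have : fderiv ℝ (fun w : JetCoord p n => f w.1) z
      = (fderiv ℝ f z.1).comp (ContinuousLinearMap.fst ℝ _ _) :=
    (hf.hasFDerivAt.comp z hasFDerivAt_fst).fderiv
  rw [der, this]; rfl

/-! Duality of the adapted bases. -/

theorem sum_kr_mul {ι : Type} [DecidableEq ι] [Fintype ι] (a : ι) (f : ι → ℝ) :
    ∑ b, kr a b * f b = f a := by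
  simp [kr]

theorem sum_kr_mul' {ι : Type} [DecidableEq ι] [Fintype ι] (a : ι) (f : ι → ℝ) :
    ∑ b, kr b a * f b = f a := by
  simp [kr]

theorem coframe_frame (E A : Idx p n) : D.coframe E z (D.frame A z) = kr E A := by
  rcases E with α | i | ⟨i, α⟩ <;> rcases A with β | j | ⟨j, β⟩ <;>
    simp [coframe, frame, kr, Pi.single_apply, apply_ite]
  by_cases h : i = j <;> simp [h, Pi.single_apply]

/-- The coframe as a linear form. -/
noncomputable def coframeLin (D : LocalData p n) (E : Idx p n) (z : JetCoord p n) : JetCoord p n →ₗ[ℝ] ℝ where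
  toFun := D.coframe E z
  map_add' v w := by
    rcases E with α | i | ⟨i, α⟩ <;> simp [coframe, mul_add, Finset.sum_add_distrib]
    ring
  map_smul' c v := by
    rcases E with α | i | ⟨i, α⟩ <;>
      simp [coframe, mul_add, Finset.mul_sum, mul_left_comm]

theorem coframe_sub (E : Idx p n) (v w : JetCoord p n) :
    D.coframe E z (v - w) = D.coframe E z v - D.coframe E z w :=
  map_sub (D.coframeLin E z) v w

theorem coframe_sum (E : Idx p n) (c : Idx p n → ℝ) :
    D.coframe E z (∑ F, c F • D.frame F z) = c E := by
  have h : D.coframe E z (∑ F, c F • D.frame F z) = ∑ F, c F * D.coframe E z (D.frame F z) := by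
    refine (map_sum (D.coframeLin E z) (fun F => c F • D.frame F z) Finset.univ).trans ?_
    exact Finset.sum_congr rfl fun F _ => map_smul (D.coframeLin E z) (c F) _
  simp only [h, coframe_frame, mul_comm (c _)]
  exact sum_kr_mul E c

/-! The curvature in the adapted basis. -/

theorem coframe_nabla (V W : JetCoord p n → JetCoord p n) (E : Idx p n) :
    D.coframe E z (D.nabla V W z) = fderiv ℝ (fun w => D.coframe E w (W w)) z (V z) +
      ∑ A, ∑ B, D.conn E A B z * D.coframe A z (W z) * D.coframe B z (V z) :=
  coframe_sum E _

theorem coframe_nabla_frame (V : JetCoord p n → JetCoord p n) (E A : Idx p n) :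
    D.coframe E z (D.nabla V (D.frame A) z) = ∑ F, D.conn E A F z * D.coframe F z (V z) := by
  rw [coframe_nabla]
  simp only [coframe_frame, fderiv_fun_const, Pi.zero_apply, zero_apply,
    zero_add]
  rw [Finset.sum_comm]
  exact Finset.sum_congr rfl fun F _ => by
    simpa [mul_comm, mul_assoc, mul_left_comm] using
      sum_kr_mul' A (fun B => D.conn E B F z * D.coframe F z (V z))

theorem coframe_nabla_frame_frame (E A B : Idx p n) :
    D.coframe E z (D.nabla (D.frame B) (D.frame A) z) = D.conn E A B z := by
  rw [coframe_nabla_frame]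
  simpa [coframe_frame, mul_comm] using sum_kr_mul' B (fun F => D.conn E A F z)

/-- The components of the inner derivative are the connection coefficients at every point, not only
at `z`, so they may be differentiated once more without any regularity assumption. -/
theorem coframe_nabla_nabla (E A B C : Idx p n) :
    D.coframe E z (D.nabla (D.frame C) (D.nabla (D.frame B) (D.frame A)) z)
      = D.der C (D.conn E A B) z + ∑ F, D.conn F A B z * D.conn E F C z := by
  rw [coframe_nabla]
  simp only [coframe_nabla_frame_frame, coframe_frame]
  congr 1
  refine Finset.sum_congr rfl fun F _ => ?_
  simpa [mul_comm, mul_assoc, mul_left_comm] using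
    sum_kr_mul' C (fun B' => D.conn F A B z * D.conn E F B' z)

/-- Vertical component of the bracket `[X_C, X_B]`. -/
noncomputable def bracketVert (D : LocalData p n) (C B : Idx p n) (m : Fin n) (μ : Fin p)
    (z : JetCoord p n) : ℝ :=
  D.der C (fun w => (D.frame B w).2.2 m μ) z - D.der B (fun w => (D.frame C w).2.2 m μ) z

/-- The temporal and spatial components of each frame field are constant; only the vertical ones
vary, through `M` and `N`. -/
theorem RegularAt.fderiv_frame (hz : D.RegularAt z) (A : Idx p n) (v : JetCoord p n) :
    fderiv ℝ (D.frame A) z v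
      = (0, 0, fun i α => fderiv ℝ (fun w => (D.frame A w).2.2 i α) z v) := by
  have hd : HasFDerivAt (D.frame A) (fderiv ℝ (D.frame A) z) z :=
    ((hz.frame_smooth A).differentiableAt (by simp)).hasFDerivAt
  have h1 : HasFDerivAt (fun w => (D.frame A w).1) (0 : JetCoord p n →L[ℝ] (Fin p → ℝ)) z := by
    rcases A with α | i | ⟨i, α⟩ <;> exact hasFDerivAt_const _ _
  have h2 : HasFDerivAt (fun w => (D.frame A w).2.1) (0 : JetCoord p n →L[ℝ] (Fin n → ℝ)) z := by
    rcases A with α | i | ⟨i, α⟩ <;> exact hasFDerivAt_const _ _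
  have h3 := hd.snd.snd
  refine Prod.ext ?_ (Prod.ext ?_ ?_)
  · exact congrArg (fun l => l v) (hd.fst.unique h1)
  · exact congrArg (fun l => l v) (hd.snd.fst.unique h2)
  · funext i α
    have h4 := (hasFDerivAt_pi'.1 ((hasFDerivAt_pi'.1 h3) i)) α
    exact congrArg (fun l => l v) h4.fderiv.symm

/-- The bracket of two frame fields is vertical, so the `M` and `N` corrections in the coframe
contribute nothing and only the vertical summands remain. -/
theorem RegularAt.sum_conn_bracket (hz : D.RegularAt z) (E A B C : Idx p n) :
    ∑ F, D.conn E A F z * D.coframe F z (VectorField.lieBracket ℝ (D.frame C) (D.frame B) z)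
      = ∑ m, ∑ μ, D.conn E A (yI m μ) z * D.bracketVert C B m μ z := by
  simp only [VectorField.lieBracket, hz.fderiv_frame, Fintype.sum_sum_type,
    Fintype.sum_prod_type]
  simp [coframe, bracketVert, der]

theorem RegularAt.curvComp_eq (hz : D.RegularAt z) (E A B C : Idx p n) :
    D.curvComp E A B C z = D.der C (D.conn E A B) z - D.der B (D.conn E A C) z
      + (∑ F, D.conn F A B z * D.conn E F C z - ∑ F, D.conn F A C z * D.conn E F B z)
      - ∑ m, ∑ μ, D.conn E A (yI m μ) z * D.bracketVert C B m μ z := by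
  rw [curvComp, curv, coframe_sub, coframe_sub, coframe_nabla_nabla, coframe_nabla_nabla,
    coframe_nabla_frame, hz.sum_conn_bracket]
  ring

theorem bracketVert_xt (k m : Fin n) (β μ : Fin p) :
    D.bracketVert (xI k) (tI β) m μ z = -D.torRtx m μ β k z := by
  simp only [bracketVert, frame, der_neg, torRtx]; ring

theorem bracketVert_xx (k j m : Fin n) (μ : Fin p) :
    D.bracketVert (xI k) (xI j) m μ z = -D.torRxx m μ j k z := by
  simp only [bracketVert, frame, der_neg, torRxx]; ring

theorem bracketVert_yt (k m : Fin n) (β γ μ : Fin p) :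
    D.bracketVert (yI k γ) (tI β) m μ z = -D.der (yI k γ) (D.tempN m μ β) z := by
  simp only [bracketVert, frame, der_neg, der_const]; ring

theorem bracketVert_yx (k j m : Fin n) (γ μ : Fin p) :
    D.bracketVert (yI k γ) (xI j) m μ z = -D.der (yI k γ) (fun w => D.N w m μ j) z := by
  simp only [bracketVert, frame, der_neg, der_const]; ring

theorem bracketVert_yy (k j m : Fin n) (γ β μ : Fin p) :
    D.bracketVert (yI k γ) (yI j β) m μ z = 0 := by
  simp only [bracketVert, frame, der_const, sub_self]

theorem bracketVert_swap (B C : Idx p n) (m : Fin n) (μ : Fin p) :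
    D.bracketVert B C m μ z = -D.bracketVert C B m μ z := by
  simp only [bracketVert]; ring

/-! ### Curvature components in the adapted basis. -/

namespace RegularAt

theorem curvComp_tttt (hz : D.RegularAt z) (α η β γ : Fin p) :
    D.curvComp (tI α) (tI η) (tI β) (tI γ) z = D.curvH α η β γ z.1 := by
  have hd : ∀ a b c, DifferentiableAt ℝ (D.chr a b c) z.1 := fun a b c =>
    (hz.chr_smooth a b c).differentiableAt (by simp)
  rw [hz.curvComp_eq]
  simp [conn, Fintype.sum_sum_type, der_comp_fst, hd, frame, curvH, Finset.sum_sub_distrib]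

theorem curvComp_xxtx (hz : D.RegularAt z) (l i k : Fin n) (β : Fin p) :
    D.curvComp (xI l) (xI i) (tI β) (xI k) z = D.curvRtx l i β k z := by
  rw [hz.curvComp_eq]
  simp [conn, Fintype.sum_sum_type, curvRtx, bracketVert_xt, Finset.sum_sub_distrib]

theorem curvComp_xxxx (hz : D.RegularAt z) (l i j k : Fin n) :
    D.curvComp (xI l) (xI i) (xI j) (xI k) z = D.curvRxx l i j k z := by
  rw [hz.curvComp_eq]
  simp [conn, Fintype.sum_sum_type, curvRxx, bracketVert_xx, Finset.sum_sub_distrib]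

theorem curvComp_xxyx (hz : D.RegularAt z) (l i j k : Fin n) (γ : Fin p) :
    D.curvComp (xI l) (xI i) (yI k γ) (xI j) z = -D.curvPx l i j k γ z := by
  -- This is the `L` part of the torsion term; it cancels the term of `C^{l(γ)}_{i(k)|j}` that
  -- corrects the vertical lower index. What remains is the general coefficient formula, with a sign
  -- because the last two indices are exchanged.
  have h1 : ∑ m, ∑ μ, D.C l i m μ z * (kr γ μ * D.L m k j z) = ∑ m, D.C l i m γ z * D.L m k j z :=
    Finset.sum_congr rfl fun m _ => by
      simpa [mul_left_comm] using sum_kr_mul γ (fun μ => D.C l i m μ z * D.L m k j z)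
  rw [hz.curvComp_eq]
  simp only [conn, Fintype.sum_sum_type, curvPx, covMC, torPx, bracketVert_swap (xI j),
    bracketVert_yx, mul_sub, Finset.sum_sub_distrib, h1]
  simp [mul_comm]
  ring

theorem der_conn_yyt (hz : D.RegularAt z) (l i : Fin n) (η α β : Fin p) (k : Fin n) (γ : Fin p) :
    D.der (yI k γ) (D.conn (yI l η) (yI i α) (tI β)) z
      = kr α η * D.der (yI k γ) (D.G l i β) z := by
  have h1 := (hz.G_smooth l i β).differentiableAt (by simp)
  have h2 := (hz.chr_fst_smooth α η β).differentiableAt (by simp)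
  have h3 : D.der (yI k γ) (fun w => D.chr α η β w.1) z = 0 := by
    rw [der_comp_fst ((hz.chr_smooth α η β).differentiableAt (by simp))]
    simp [frame]
  simp only [conn]
  rw [der_sub _ (h1.const_mul _) (h2.const_mul _), der_const_mul, der_const_mul, h3]
  ring

theorem curvComp_yyty (hz : D.RegularAt z) (l i k : Fin n) (η α β γ : Fin p) :
    D.curvComp (yI l η) (yI i α) (tI β) (yI k γ) z = kr α η * D.curvPt l i β k γ z := by
  rw [hz.curvComp_eq, hz.der_conn_yyt]
  by_cases h : α = η
  -- The torsion terms in `G` and `H` cancel the corrections for the vertical index pair inside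
  -- `C^{l(γ)}_{i(k)/β}`, leaving the derivative of `M` that comes from the bracket.
  · subst h
    simp only [conn, Fintype.sum_sum_type, Fintype.sum_prod_type, curvPt, covTC, torPt,
      bracketVert_yt]
    simp only [kr]
    simp [Finset.sum_sub_distrib, Finset.sum_add_distrib, mul_sub, sub_mul, mul_add]
    have hc : ∑ m, D.G m i β z * D.C l m k γ z = ∑ m, D.C l m k γ z * D.G m i β z :=
      Finset.sum_congr rfl fun m _ => mul_comm _ _
    rw [hc]
    ring
  -- Off the diagonal the temporal coefficient is only the Christoffel part; its two products with
  -- `C` are equal and enter with opposite signs.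
  · simp only [conn, Fintype.sum_sum_type, Fintype.sum_prod_type]
    simp only [kr]
    simp [h, der_const, Finset.sum_sub_distrib, mul_sub, sub_mul]
    ring

theorem curvComp_yyxy (hz : D.RegularAt z) (l i j k : Fin n) (η α γ : Fin p) :
    D.curvComp (yI l η) (yI i α) (xI j) (yI k γ) z = kr α η * D.curvPx l i j k γ z := by
  rw [hz.curvComp_eq]
  by_cases h : α = η
  · subst h
    simp only [conn, Fintype.sum_sum_type, Fintype.sum_prod_type, curvPx, covMC, torPx,
      bracketVert_yx]
    simp only [kr]
    simp [Finset.sum_sub_distrib, mul_sub]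
    have hc : ∑ m, D.L m i j z * D.C l m k γ z = ∑ m, D.C l m k γ z * D.L m i j z :=
      Finset.sum_congr rfl fun m _ => mul_comm _ _
    rw [hc]
    ring
  · simp [conn, Fintype.sum_sum_type, Fintype.sum_prod_type, kr, h, der_const]

theorem curvComp_yyyy (hz : D.RegularAt z) (l i j k : Fin n) (η α β γ : Fin p) :
    D.curvComp (yI l η) (yI i α) (yI j β) (yI k γ) z = kr α η * D.curvS l i j β k γ z := by
  rw [hz.curvComp_eq]
  by_cases h : α = η
  · subst h
    simp [conn, Fintype.sum_sum_type, Fintype.sum_prod_type, curvS, bracketVert_yy, kr,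
      Finset.sum_sub_distrib]
  · simp [conn, Fintype.sum_sum_type, Fintype.sum_prod_type, kr, h, der_const]

/-! ### The nine blocks of the Ricci tensor and the scalar curvature. -/

theorem ric_tt (hz : D.RegularAt z) (α β : Fin p) : D.ric (tI α) (tI β) z = D.ricH α β z := by
  simp [ric, Fintype.sum_sum_type, hz.curvComp_tttt, ricH]
  -- The remaining summands have their first two curvature indices in different blocks; they vanish
  -- because the connection preserves the three distributions.
  simp [hz.curvComp_eq, conn, Fintype.sum_sum_type, der_const]

theorem ric_tx (hz : D.RegularAt z) (α : Fin p) (j : Fin n) : D.ric (tI α) (xI j) z = 0 := by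
  have hd : ∀ a b c, DifferentiableAt ℝ (D.chr a b c) z.1 := fun a b c =>
    (hz.chr_smooth a b c).differentiableAt (by simp)
  simp [ric, hz.curvComp_eq, conn, Fintype.sum_sum_type, der_const, der_comp_fst, hd, frame]

/-- As for a spatial second index, the only candidates are temporal curvatures with a non-temporal
argument. The coefficients there are zero, or Christoffel symbols differentiated in a direction that
does not change `t`. -/
theorem ric_ty (hz : D.RegularAt z) (α : Fin p) (j : Fin n) (β : Fin p) :
    D.ric (tI α) (yI j β) z = 0 := by
  have hd : ∀ a b c, DifferentiableAt ℝ (D.chr a b c) z.1 := fun a b c =>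
    (hz.chr_smooth a b c).differentiableAt (by simp)
  simp [ric, hz.curvComp_eq, conn, Fintype.sum_sum_type, der_const, der_comp_fst, hd, frame]

theorem ric_xt (hz : D.RegularAt z) (i : Fin n) (β : Fin p) :
    D.ric (xI i) (tI β) z = D.ricRt i β z := by
  simp [ric, Fintype.sum_sum_type, hz.curvComp_xxtx, ricRt]
  simp [hz.curvComp_eq, conn, Fintype.sum_sum_type, der_const]

theorem ric_xx (hz : D.RegularAt z) (i j : Fin n) :
    D.ric (xI i) (xI j) z = D.ricR i j z := by
  simp [ric, Fintype.sum_sum_type, hz.curvComp_xxxx, ricR]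
  simp [hz.curvComp_eq, conn, Fintype.sum_sum_type, der_const]

theorem ric_xy (hz : D.RegularAt z) (i j : Fin n) (β : Fin p) :
    D.ric (xI i) (yI j β) z = D.ricPxy i j β z := by
  simp [ric, Fintype.sum_sum_type, hz.curvComp_xxyx, ricPxy]
  simp [hz.curvComp_eq, conn, Fintype.sum_sum_type, der_const]

theorem ric_yt (hz : D.RegularAt z) (i : Fin n) (α β : Fin p) :
    D.ric (yI i α) (tI β) z = D.ricPyt i α β z := by
  simp [ric, Fintype.sum_sum_type, Fintype.sum_prod_type, hz.curvComp_yyty, ricPyt, sum_kr_mul]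
  simp [hz.curvComp_eq, conn, Fintype.sum_sum_type, der_const]

theorem ric_yx (hz : D.RegularAt z) (i : Fin n) (α : Fin p) (j : Fin n) :
    D.ric (yI i α) (xI j) z = D.ricPyx i α j z := by
  simp [ric, Fintype.sum_sum_type, Fintype.sum_prod_type, hz.curvComp_yyxy, ricPyx, sum_kr_mul]
  simp [hz.curvComp_eq, conn, Fintype.sum_sum_type, der_const]

theorem ric_yy (hz : D.RegularAt z) (i : Fin n) (α : Fin p) (j : Fin n) (β : Fin p) :
    D.ric (yI i α) (yI j β) z = D.ricS i α j β z := by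
  simp [ric, Fintype.sum_sum_type, Fintype.sum_prod_type, hz.curvComp_yyyy, ricS, sum_kr_mul]
  simp [hz.curvComp_eq, conn, Fintype.sum_sum_type, der_const]

/-- The inverse metric is block diagonal, so only the three diagonal Ricci blocks are traced. -/
theorem sc_eq (hz : D.RegularAt z) : D.sc z = D.scH z + D.scR z + D.scS z := by
  have hS : ∑ i, ∑ α, ∑ j, ∑ β, D.h z.1 α β * (D.g z)⁻¹ i j * D.ricS i α j β z = D.scS z := by
    rw [scS, Finset.sum_comm]
    refine Finset.sum_congr rfl fun α _ => ?_
    rw [Finset.sum_comm (s := Finset.univ (α := Fin p))]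
    exact Finset.sum_congr rfl fun i _ => Finset.sum_comm
  simp [sc, Fintype.sum_sum_type, Fintype.sum_prod_type, metInv, hz.ric_tt, hz.ric_xx, hz.ric_yy,
    hS, scH, scR, add_assoc]

end RegularAt

/-! ### The mixed Einstein tensor. -/

theorem inv_mul_apply_eq_kr {k : ℕ} {A : Matrix (Fin k) (Fin k) ℝ} (hA : A.det ≠ 0) (i j : Fin k) :
    ∑ r, A⁻¹ i r * A r j = kr i j := by
  rw [← Matrix.mul_apply, Matrix.nonsing_inv_mul _ hA.isUnit, Matrix.one_apply, kr]

theorem mul_inv_apply_eq_kr {k : ℕ} {A : Matrix (Fin k) (Fin k) ℝ} (hA : A.det ≠ 0) (i j : Fin k) :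
    ∑ r, A i r * A⁻¹ r j = kr i j := by
  rw [← Matrix.mul_apply, Matrix.mul_nonsing_inv _ hA.isUnit, Matrix.one_apply, kr]

/-- The mixed components `G^{BE} (R_{EA} - (Sc/2) G_{EA})` of the Einstein tensor. -/
noncomputable def einstein (D : LocalData p n) : Idx p n → Idx p n → JetCoord p n → ℝ
  | Sum.inl μ, Sum.inl β => fun w => D.mixH μ β w - (D.scH w + D.scR w + D.scS w) / 2 * kr μ β
  | Sum.inl _, Sum.inr _ => fun _ => 0
  | Sum.inr (Sum.inl m), Sum.inl β => D.mixRt m β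
  | Sum.inr (Sum.inl m), Sum.inr (Sum.inl j) => fun w =>
      D.mixR m j w - (D.scH w + D.scR w + D.scS w) / 2 * kr m j
  | Sum.inr (Sum.inl m), Sum.inr (Sum.inr (j, β)) => D.mixPxy m j β
  | Sum.inr (Sum.inr (m, μ)), Sum.inl β => D.mixPyt m μ β
  | Sum.inr (Sum.inr (m, μ)), Sum.inr (Sum.inl j) => D.mixPyx m μ j
  | Sum.inr (Sum.inr (m, μ)), Sum.inr (Sum.inr (j, β)) => fun w =>
      D.mixS m μ j β w - (D.scH w + D.scR w + D.scS w) / 2 * kr m j * kr β μ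

theorem RegularAt.raise_met (hz : D.RegularAt z) (B A : Idx p n) :
    D.raise D.met B A z = kr B A := by
  -- The vertical metric is the Kronecker product of `h⁻¹` and `g`, hence its inverse is that of `h`
  -- and `g⁻¹`.
  have hy : ∀ (i j : Fin n) (α β : Fin p), ∑ r, ∑ γ,
      D.h z.1 α γ * (D.g z)⁻¹ i r * ((D.h z.1)⁻¹ γ β * D.g z r j) = kr i j * kr α β := by
    intro i j α β
    rw [← inv_mul_apply_eq_kr hz.g_det, ← mul_inv_apply_eq_kr hz.h_det, Finset.sum_mul_sum]
    exact Finset.sum_congr rfl fun r _ => Finset.sum_congr rfl fun γ _ => by ring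
  rcases B with α | i | ⟨i, α⟩ <;> rcases A with β | j | ⟨j, β⟩ <;>
    simp [raise, metInv, met, Fintype.sum_sum_type, Fintype.sum_prod_type,
      inv_mul_apply_eq_kr, hz.h_det, hz.g_det, hy]
  all_goals simp [kr, ← ite_and, and_comm]

/-- Raising turns the metric into the identity, so the scalar curvature enters only through a
Kronecker symbol; the Ricci part is read off block by block. -/
theorem RegularAt.raise_ric (hz : D.RegularAt z) (B A : Idx p n) :
    D.raise (fun A B w => D.ric A B w - D.sc w / 2 * D.met A B w) B A z = D.einstein B A z := by
  have h : D.raise (fun A B w => D.ric A B w - D.sc w / 2 * D.met A B w) B A z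
      = D.raise D.ric B A z - (D.scH z + D.scR z + D.scS z) / 2 * kr B A := by
    rw [← hz.raise_met, ← hz.sc_eq]
    simp only [raise, mul_sub, Finset.sum_sub_distrib, Finset.mul_sum]
    congr 1
    exact Finset.sum_congr rfl fun _ _ => by ring
  rw [h]
  rcases B with α | i | ⟨i, α⟩ <;> rcases A with β | j | ⟨j, β⟩ <;>
    simp [raise, metInv, Fintype.sum_sum_type, Fintype.sum_prod_type, einstein,
      hz.ric_tt, hz.ric_tx, hz.ric_ty, hz.ric_xt, hz.ric_xx, hz.ric_xy, hz.ric_yt, hz.ric_yx,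
      hz.ric_yy, mixH, mixRt, mixR, mixPxy, mixPyt, mixPyx, mixS, mul_comm (D.h z.1 _ _)]
  all_goals simp [kr, ite_and, @eq_comm (Fin p)]
  split_ifs <;> rfl

/-- Agreement near `z` is required, not only at `z`, since the components are differentiated. -/
theorem covDer_congr {X Y : Idx p n → Idx p n → JetCoord p n → ℝ}
    (h : ∀ A B, X A B =ᶠ[nhds z] Y A B) (B A C : Idx p n) :
    D.covDer X B A C z = D.covDer Y B A C z := by
  simp only [covDer, der_congr C (h B A), (h _ _).eq_of_nhds]

theorem covDer_const_mul (c : ℝ) (X : Idx p n → Idx p n → JetCoord p n → ℝ) (B A C : Idx p n) :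
    D.covDer (fun A B w => c * X A B w) B A C z = c * D.covDer X B A C z := by
  simp only [covDer, der_const_mul, mul_add, mul_sub, Finset.mul_sum, mul_left_comm]

/-! The divergence of the Einstein tensor. -/

theorem sum_covDer_einstein_t (β : Fin p) :
    ∑ B, D.covDer D.einstein B (tI β) B z
      = ∑ μ, D.covTtt (fun μ β w =>
          D.mixH μ β w - (D.scH w + D.scR w + D.scS w) / 2 * kr μ β) μ β μ z
        + (∑ m, D.covMxt D.mixRt m β m z + ∑ m, ∑ μ, D.covVyt D.mixPyt m μ β m μ z) := by
  rw [Fintype.sum_sum_type, Fintype.sum_sum_type, Fintype.sum_prod_type]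
  refine congrArg₂ _ (Finset.sum_congr rfl fun μ _ => ?_) (congrArg₂ _
    (Finset.sum_congr rfl fun m _ => ?_)
    (Finset.sum_congr rfl fun m _ => Finset.sum_congr rfl fun μ _ => ?_))
  · simp [covDer, covTtt, conn, Fintype.sum_sum_type, einstein, mul_comm]
  · simp [covDer, covMxt, conn, Fintype.sum_sum_type, einstein, mul_comm]
  · simp [covDer, covVyt, conn, Fintype.sum_sum_type, Fintype.sum_prod_type, einstein, kr, mul_comm]

theorem sum_covDer_einstein_x (j : Fin n) :
    ∑ B, D.covDer D.einstein B (xI j) B z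
      = ∑ m, D.covMxx (fun m j w =>
          D.mixR m j w - (D.scH w + D.scR w + D.scS w) / 2 * kr m j) m j m z
        + ∑ m, ∑ μ, D.covVyx D.mixPyx m μ j m μ z := by
  -- The components with temporal upper and spatial lower index vanish identically, and the
  -- connection mixes in no other block. Hence the second law has no temporal divergence term.
  have h0 : ∑ μ, D.covDer D.einstein (tI μ) (xI j) (tI μ) z = 0 := by
    simp [covDer, conn, Fintype.sum_sum_type, einstein, der_const]
  rw [Fintype.sum_sum_type, Fintype.sum_sum_type, Fintype.sum_prod_type, h0, zero_add]
  refine congrArg₂ _ (Finset.sum_congr rfl fun m _ => ?_)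
    (Finset.sum_congr rfl fun m _ => Finset.sum_congr rfl fun μ _ => ?_)
  · simp [covDer, covMxx, conn, Fintype.sum_sum_type, einstein, mul_comm]
  · simp [covDer, covVyx, conn, Fintype.sum_sum_type, Fintype.sum_prod_type, einstein, kr, mul_comm]

theorem sum_covDer_einstein_y (j : Fin n) (β : Fin p) :
    ∑ B, D.covDer D.einstein B (yI j β) B z
      = ∑ m, D.covMxy D.mixPxy m j β m z
        + ∑ m, ∑ μ, D.covVyy (fun m μ j β w => D.mixS m μ j β w
          - (D.scH w + D.scR w + D.scS w) / 2 * kr m j * kr β μ) m μ j β m μ z := by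
  have h0 : ∑ μ, D.covDer D.einstein (tI μ) (yI j β) (tI μ) z = 0 := by
    simp [covDer, conn, Fintype.sum_sum_type, einstein, der_const]
  -- Along spatial and vertical directions the vertical coefficients are `L` or `C` times a
  -- Kronecker symbol in the temporal indices, so sums over vertical index pairs collapse to spatial
  -- sums: here for the lower pair, in `h2` for the upper one.
  have h1 : ∀ (f : Fin n → Fin p → ℝ) (c : Fin n → ℝ),
      ∑ r, ∑ ν, kr β ν * c r * f r ν = ∑ r, c r * f r β := fun f c =>
    Finset.sum_congr rfl fun r _ => by
      simpa [mul_assoc] using sum_kr_mul β (fun ν => c r * f r ν)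
  have h2 : ∀ (μ : Fin p) (f : Fin n → Fin p → ℝ) (c : Fin n → ℝ),
      ∑ r, ∑ ν, kr ν μ * c r * f r ν = ∑ r, c r * f r μ := fun μ f c =>
    Finset.sum_congr rfl fun r _ => by
      simpa [mul_assoc] using sum_kr_mul' μ (fun ν => c r * f r ν)
  rw [Fintype.sum_sum_type, Fintype.sum_sum_type, Fintype.sum_prod_type, h0, zero_add]
  refine congrArg₂ _ (Finset.sum_congr rfl fun m _ => ?_)
    (Finset.sum_congr rfl fun m _ => Finset.sum_congr rfl fun μ _ => ?_)
  · simp only [covDer, covMxy, conn, Fintype.sum_sum_type, Fintype.sum_prod_type, einstein, h1]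
    simp [mul_comm]
  · simp only [covDer, covVyy, conn, Fintype.sum_sum_type, Fintype.sum_prod_type, einstein,
      h1 (fun r ν => D.mixS m μ r ν z - (D.scH z + D.scR z + D.scS z) / 2 * kr m r * kr ν μ),
      h2 μ (fun r ν => D.mixS r ν j β z - (D.scH z + D.scR z + D.scS z) / 2 * kr r j * kr β ν)]
    simp [mul_comm]

end LocalData

/-! ### From the equations on `J¹(T,M)` to a single induced chart. -/

section Global

theorem isOpen_dom {p n : ℕ} {T M : Type*} [TopologicalSpace T] [TopologicalSpace M]
    {φ : OpenPartialHomeomorph T (Fin p → ℝ)} {ψ : OpenPartialHomeomorph M (Fin n → ℝ)} :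
    IsOpen (dom φ ψ) :=
  (φ.open_target.preimage continuous_fst).inter
    (ψ.open_target.preimage (continuous_fst.comp continuous_snd))

variable {p n : ℕ} {T M : Type*}
  [TopologicalSpace T] [ChartedSpace (Fin p → ℝ) T]
  [TopologicalSpace M] [ChartedSpace (Fin n → ℝ) M]
  {𝒮 : Space p n T M} {Γ : SpatialConnection 𝒮}
  {φ : OpenPartialHomeomorph T (Fin p → ℝ)} {ψ : OpenPartialHomeomorph M (Fin n → ℝ)}
  {z : JetCoord p n}

theorem regularAt_localData (hφ : φ ∈ charts p T) (hψ : ψ ∈ charts n M) (hz : z ∈ dom φ ψ) :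
    (localData 𝒮 Γ φ ψ).RegularAt z where
  h_smooth α β := (𝒮.h_smooth φ hφ α β).contDiffAt (φ.open_target.mem_nhds hz.1)
  h_det := 𝒮.h_det φ hφ _ hz.1
  g_smooth i j := (𝒮.g_smooth φ hφ ψ hψ i j).contDiffAt (isOpen_dom.mem_nhds hz)
  g_det := 𝒮.g_det φ hφ ψ hψ _ hz
  N_smooth i α j := (Γ.smooth φ hφ ψ hψ i α j).contDiffAt (isOpen_dom.mem_nhds hz)

theorem sum_covDer_einstein_eq_zero {𝒦 : ℝ} {𝒯 : Tensor2 𝒮 Γ} (hE : EinsteinEquations 𝒮 Γ 𝒦 𝒯)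
    (hC : ConservationLaws 𝒮 Γ 𝒯) (hφ : φ ∈ charts p T) (hψ : ψ ∈ charts n M)
    (hz : z ∈ dom φ ψ) (A : Idx p n) :
    ∑ B, (localData 𝒮 Γ φ ψ).covDer (localData 𝒮 Γ φ ψ).einstein B A B z = 0 := by
  -- The Einstein equations hold on the whole open coordinate domain, so the mixed form holds in a
  -- neighbourhood of `z` and can be differentiated there.
  have h : ∀ A B, (localData 𝒮 Γ φ ψ).einstein A B =ᶠ[nhds z]
      fun w => 𝒦 * (localData 𝒮 Γ φ ψ).raise (𝒯.comp φ ψ) A B w := fun A B => by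
    filter_upwards [isOpen_dom.mem_nhds hz] with w hw
    rw [← (regularAt_localData hφ hψ hw).raise_ric]
    simp only [LocalData.raise, Finset.mul_sum, hE φ hφ ψ hψ w hw, mul_left_comm]
  simp only [LocalData.covDer_congr h, LocalData.covDer_const_mul, ← Finset.mul_sum]
  exact mul_eq_zero_of_right _ (hC φ hφ ψ hψ z hz A)

end Global

end GML

open GML in
theorem mainTheorem5 (p n : ℕ) (T M : Type*)
    [TopologicalSpace T] [ChartedSpace (Fin p → ℝ) T] [IsManifold 𝓘(ℝ, Fin p → ℝ) ∞ T]
    [TopologicalSpace M] [ChartedSpace (Fin n → ℝ) M] [IsManifold 𝓘(ℝ, Fin n → ℝ) ∞ M]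
    (𝒮 : Space p n T M) (Γ : SpatialConnection 𝒮) (𝒦 : ℝ) (𝒯 : Tensor2 𝒮 Γ)
    (hE : EinsteinEquations 𝒮 Γ 𝒦 𝒯) (hC : ConservationLaws 𝒮 Γ 𝒯)
    (φ : OpenPartialHomeomorph T (Fin p → ℝ)) (hφ : φ ∈ charts p T)
    (ψ : OpenPartialHomeomorph M (Fin n → ℝ)) (hψ : ψ ∈ charts n M)
    (D : LocalData p n) (hD : D = localData 𝒮 Γ φ ψ)
    (z : JetCoord p n) (hz : z ∈ dom φ ψ) :
    (∀ β : Fin p,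
      ∑ μ, D.covTtt (fun μ β w => D.mixH μ β w - (D.scH w + D.scR w + D.scS w) / 2 * kr μ β) μ β μ z
        = -(∑ m, D.covMxt D.mixRt m β m z) - ∑ m, ∑ μ, D.covVyt D.mixPyt m μ β m μ z) ∧
    (∀ j : Fin n,
      ∑ m, D.covMxx (fun m j w => D.mixR m j w - (D.scH w + D.scR w + D.scS w) / 2 * kr m j) m j m z
        = -∑ m, ∑ μ, D.covVyx D.mixPyx m μ j m μ z) ∧
    (∀ (j : Fin n) (β : Fin p),
      ∑ m, ∑ μ, D.covVyy (fun m μ j β w => D.mixS m μ j β w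
          - (D.scH w + D.scR w + D.scS w) / 2 * kr m j * kr β μ) m μ j β m μ z
        = -∑ m, D.covMxy D.mixPxy m j β m z) := by
  subst hD
  have h := sum_covDer_einstein_eq_zero hE hC hφ hψ hz
  refine ⟨fun β => ?_, fun j => ?_, fun j β => ?_⟩
  · linarith [LocalData.sum_covDer_einstein_t (D := localData 𝒮 Γ φ ψ) (z := z) β, h (tI β)]
  · linarith [LocalData.sum_covDer_einstein_x (D := localData 𝒮 Γ φ ψ) (z := z) j, h (xI j)]
  · linarith [LocalData.sum_covDer_einstein_y (D := localData 𝒮 Γ φ ψ) (z := z) j β, h (yI j β)]
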